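/- Let $M$ and $N$ be smooth compact $d$-dimensional manifolds without boundary, let $M$ carry a smooth Riemannian metric, and let $\mathrm{d}x$ be its Riemannian volume. Let $D_+^1(M)$ be the set of strictly positive $C^1$ functions on $M$ with integral $1$ with respect to $\mathrm{d}x$; an element is identified with the probability measure that has it as density. For a measure $\rho$ and a map $f$ write $f_\#\rho$ for the pushforward measure and, when it has a continuous density, also for that density. Let $\boldsymbol{G}$ be the set of pairs $(y,h)\in C^1(M,\mathbb{R})\times \mathrm{Diff}^1(M,M)$ for which the delay map $x\mapsto (y(x),y(h(x)),\dots,y(h^{2d}(x)))$ is a $C^1$ embedding of $M$ into $\mathbb{R}^{2d+1}$ (an injective $C^1$ map with injective differentials that is a homeomorphism onto its image). Fix $m>2d+1$. Let $\rho_1\in D_+^1(M)$, let $h$ be a $C^2$ diffeomorphism of $M$, and assume $(\rho_1/h_\#\rho_1,\,h)\in\boldsymbol{G}$. Set $\rho_j=(h^{j-1})_\#\rho_1$ for $1\le j\le m$, where $h^0=\mathrm{id}$. Then both of the following hold. (K1) If $f,g:M\to N$ are $C^1$ diffeomorphisms with $f_\#\rho_j=g_\#\rho_j$ for all $1\le j\le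 m$, then $f=g$. (K2) If $v,w$ are $C^1$ vector fields on $M$ with $\operatorname{div}(\rho_j v)=\operatorname{div}(\rho_j w)$ on $M$ for all $1\le j\le m$, where $\operatorname{div}$ is the Riemannian divergence, then $v=w$. -/

import Mathlib

open MeasureTheory
open scoped Manifold ContDiff

noncomputable section

/-- The model space `ℝᵈ` with its Euclidean norm. -/
abbrev Rd (d : ℕ) : Type := EuclideanSpace ℝ (Fin d)

/-- The `i`-th standard basis vector of `ℝᵈ`. -/
def stdVec {d : ℕ} (i : Fin d) : Rd d := EuclideanSpace.single i (1 : ℝ)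

/-- Smooth Riemannian metrics on a `d`-dimensional manifold `M`. -/
abbrev SmoothMetric (d : ℕ) (M : Type*) [TopologicalSpace M] [ChartedSpace (Rd d) M]
    [IsManifold (𝓡 d) ∞ M] :=
  Bundle.ContMDiffRiemannianMetric (𝓡 d) ∞ (Rd d) (fun x : M => TangentSpace (𝓡 d) x)

section Riemannian

variable {d : ℕ} {M : Type*} [TopologicalSpace M] [ChartedSpace (Rd d) M]
  [IsManifold (𝓡 d) ∞ M]

/-- The coordinate vector field `∂ᵢ` of the chart at `x`, at the point with coordinates `u`. -/
def chartBasisVec (x : M) (u : Rd d) (i : Fin d) :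
    TangentSpace (𝓡 d) ((extChartAt (𝓡 d) x).symm u) :=
  mfderiv 𝓘(ℝ, Rd d) (𝓡 d) (extChartAt (𝓡 d) x).symm u (stdVec i)

/-- The matrix `r_{ij} = ⟨∂ᵢ, ∂ⱼ⟩` of the metric `r` in the chart at `x`. -/
def chartGram (r : SmoothMetric d M) (x : M) (u : Rd d) : Matrix (Fin d) (Fin d) ℝ :=
  Matrix.of fun i j =>
    r.inner ((extChartAt (𝓡 d) x).symm u) (chartBasisVec x u i) (chartBasisVec x u j)

/-- The Riemannian volume factor `√(det r_{ij})` in the chart at `x`. -/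
def chartVolumeFactor (r : SmoothMetric d M) (x : M) (u : Rd d) : ℝ :=
  Real.sqrt (chartGram r x u).det

/-- The Riemannian volume on the domain of the chart at `x` (and zero outside of this domain):
the image of `√(det r_{ij}) du` under the inverse of the chart. -/
def chartVolume [MeasurableSpace M] (r : SmoothMetric d M) (x : M) : Measure M :=
  Measure.map (extChartAt (𝓡 d) x).symm
    ((volume.restrict (extChartAt (𝓡 d) x).target).withDensity
      fun u => ENNReal.ofReal (chartVolumeFactor r x u))

/-- The Riemannian volume measure. The measures `chartVolume r x` agree on the overlaps of the
chart domains, and their supremum is the measure that restricts to each of them. -/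
def riemannianVolume [MeasurableSpace M] (r : SmoothMetric d M) : Measure M :=
  ⨆ x : M, chartVolume r x

/-- The components `vⁱ` of the vector field `v` in the chart at `x`, as a function of the
coordinates `u`. -/
def chartComponents (v : ∀ p : M, TangentSpace (𝓡 d) p) (x : M) (u : Rd d) : Rd d :=
  mfderiv (𝓡 d) 𝓘(ℝ, Rd d) (extChartAt (𝓡 d) x) ((extChartAt (𝓡 d) x).symm u)
    (v ((extChartAt (𝓡 d) x).symm u))

/-- The Riemannian divergence, `div v = (det r)^{-1/2} ∑ᵢ ∂ᵢ ((det r)^{1/2} vⁱ)`, computed at `x`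
in the chart at `x` (the value does not depend on the chart). -/
def riemannianDiv (r : SmoothMetric d M) (v : ∀ p : M, TangentSpace (𝓡 d) p) (x : M) : ℝ :=
  (chartVolumeFactor r x (extChartAt (𝓡 d) x x))⁻¹ *
    ∑ i : Fin d, fderiv ℝ (fun u : Rd d => chartVolumeFactor r x u * chartComponents v x u i)
      (extChartAt (𝓡 d) x x) (stdVec i)

/-- `C¹` vector fields on `M`. -/
def IsC1VectorField (v : ∀ p : M, TangentSpace (𝓡 d) p) : Prop :=
  ContMDiff (𝓡 d) (𝓡 d).tangent 1 fun p => (⟨p, v p⟩ : TangentBundle (𝓡 d) M)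

/-- The strictly positive `C¹` probability densities on `M`. -/
structure IsPosC1Density [MeasurableSpace M] (r : SmoothMetric d M) (ρ : M → ℝ) : Prop where
  contMDiff : ContMDiff (𝓡 d) 𝓘(ℝ, ℝ) 1 ρ
  pos : ∀ x, 0 < ρ x
  integral_eq_one : ∫ x, ρ x ∂(riemannianVolume r) = 1

/-- The measure on `M` with density `ρ` with respect to the Riemannian volume. -/
def measureOfDensity [MeasurableSpace M] (r : SmoothMetric d M) (ρ : M → ℝ) : Measure M :=
  (riemannianVolume r).withDensity fun x => ENNReal.ofReal (ρ x)

open Classical in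
/-- The density of the measure `μ` with respect to the Riemannian volume: the continuous
function `p ≥ 0` with `μ = p dx`, which is unique if it exists (and `0` if there is none). By
change of variables it exists for the image of a positive `C¹` density under a `C¹`
diffeomorphism of `M`. -/
def densityOf [MeasurableSpace M] (r : SmoothMetric d M) (μ : Measure M) : M → ℝ :=
  if h : ∃ p : M → ℝ, Continuous p ∧ (∀ x, 0 ≤ p x) ∧ μ = measureOfDensity r p then h.choose
  else 0

end Riemannian

section Embedding

variable {d : ℕ} {M : Type*} [TopologicalSpace M] [ChartedSpace (Rd d) M]

/-- `C¹` embeddings of `M` into `ℝⁿ`. -/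
structure IsC1Embedding {n : ℕ} (Y : M → Rd n) : Prop where
  contMDiff : ContMDiff (𝓡 d) 𝓘(ℝ, Rd n) 1 Y
  injective : Function.Injective Y
  injective_mfderiv : ∀ x : M, Function.Injective (mfderiv (𝓡 d) 𝓘(ℝ, Rd n) Y x)
  isEmbedding : Topology.IsEmbedding Y

end Embedding

/-- The delay map `x ↦ (y(x), y(h(x)), …, y(h^{k-1}(x)))`. -/
def delayMap {M : Type*} (y : M → ℝ) (h : M → M) (k : ℕ) (x : M) : Rd k :=
  WithLp.toLp 2 fun i : Fin k => y (h^[(i : ℕ)] x)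

/-- The set of pairs `(y, h)` of a `C¹` observable `y` and a `C¹` diffeomorphism `h` of `M` whose
delay map `M → ℝ^{2d+1}` is an embedding. -/
def takensSet (d : ℕ) (M : Type*) [TopologicalSpace M] [ChartedSpace (Rd d) M] :
    Set ((M → ℝ) × (M ≃ₘ^1⟮𝓡 d, 𝓡 d⟯ M)) :=
  {q | ContMDiff (𝓡 d) 𝓘(ℝ, ℝ) 1 q.1 ∧ IsC1Embedding (d := d) (delayMap q.1 q.2 (2 * d + 1))}

/-- A `C²` diffeomorphism, seen as a `C¹` diffeomorphism. -/
def diffToC1 {d : ℕ} {M : Type*} [TopologicalSpace M] [ChartedSpace (Rd d) M]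
    (h : M ≃ₘ^2⟮𝓡 d, 𝓡 d⟯ M) : M ≃ₘ^1⟮𝓡 d, 𝓡 d⟯ M where
  toEquiv := h.toEquiv
  contMDiff_toFun := h.contMDiff.of_le one_le_two
  contMDiff_invFun := h.symm.contMDiff.of_le one_le_two

section Uniqueness

variable {d m : ℕ} {M : Type*} [TopologicalSpace M] [ChartedSpace (Rd d) M] [MeasurableSpace M]

/-- The probability measures `(h^{j-1})_# ρ₁` for `1 ≤ j ≤ m` (here `j - 1` is the index), where
`ρ₁` is a density. -/
def iteratedPushforward [IsManifold (𝓡 d) ∞ M] (r : SmoothMetric d M) (ρ₁ : M → ℝ) (h : M → M)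
    (m : ℕ) (j : Fin m) : Measure M :=
  Measure.map (h^[(j : ℕ)]) (measureOfDensity r ρ₁)

/-- Pushforward uniqueness: a `C¹` diffeomorphism `f : M → N` is determined by the measures
`f_# ρⱼ`. -/
def PushforwardUniqueness (N : Type*) [TopologicalSpace N] [ChartedSpace (Rd d) N]
    [MeasurableSpace N] (ρ : Fin m → Measure M) : Prop :=
  ∀ f g : M ≃ₘ^1⟮𝓡 d, 𝓡 d⟯ N,
    (∀ j, Measure.map f (ρ j) = Measure.map g (ρ j)) → f = g

/-- Weighted-divergence uniqueness: a `C¹` vector field `v` is determined by the functions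
`div (ρⱼ v)`. -/
def DivergenceUniqueness [IsManifold (𝓡 d) ∞ M] (r : SmoothMetric d M)
    (ρ : Fin m → Measure M) : Prop :=
  ∀ v w : ∀ p : M, TangentSpace (𝓡 d) p, IsC1VectorField v → IsC1VectorField w →
    (∀ j x, riemannianDiv r (fun p => densityOf r (ρ j) p • v p) x =
      riemannianDiv r (fun p => densityOf r (ρ j) p • w p) x) → v = w

end Uniqueness

end

/-! Put `y = ρ₁ / h_# ρ₁` and `μ_k = (h^k)_# ρ₁`. Since `h_# ρ₁ = y⁻¹ ρ₁`, pushing forward by `h^k`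
gives `μ_{k+1} = (y ∘ h^{-k})⁻¹ μ_k`: ratios of consecutive measures record `y` along backward
orbits (`map_iterate_succ_eq_withDensity`). The `2d + 2` available measures give this for `0 ≤ k ≤
2d`, and these values at `x` are the coordinates, in reverse order, of the delay map at `h^{-2d} x`.

(K1) The density of `f_# μ_{k+1}` relative to `f_# μ_k` is `(y ∘ h^{-k} ∘ f⁻¹)⁻¹`. Equal
pushforwards thus give `y ∘ h^{-k} ∘ f⁻¹ = y ∘ h^{-k} ∘ g⁻¹`, and injectivity of the delay map gives
`f⁻¹ = g⁻¹`.

(K2) With `q_k = y ∘ h^{-k}` and `P_k` the density of `μ_k`, `P_k = q_k P_{k+1}`, so `div (P_k v) =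
q_k div (P_{k+1} v) + P_{k+1} dq_k(v)`. Equal divergences give `dq_k(v) = dq_k(w)`, and injectivity
of the differential of the delay map gives `v = w`. -/

open Set Filter Function
open scoped Topology ENNReal

/-! ### Regularity in charts and the Leibniz rule for the divergence -/

section ChartCalculus

variable {d : ℕ} {M : Type*} [TopologicalSpace M] [ChartedSpace (Rd d) M]
  [IsManifold (𝓡 d) ∞ M]

theorem mfderiv_extChartAt_chartBasisVec (x : M) {u : Rd d}
    (hu : u ∈ (extChartAt (𝓡 d) x).target) (i : Fin d) :
    mfderiv (𝓡 d) 𝓘(ℝ, Rd d) (extChartAt (𝓡 d) x) ((extChartAt (𝓡 d) x).symm u)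
      (chartBasisVec x u i) = stdVec i := by
  have : IsManifold (𝓡 d) 1 M := IsManifold.of_le (n := ∞) (by simp)
  have h := mfderiv_extChartAt_comp_mfderivWithin_extChartAt_symm (I := 𝓡 d) hu
  have hr : Set.range (𝓡 d) = Set.univ := by simp
  rw [hr, mfderivWithin_univ] at h
  exact DFunLike.congr_fun h (stdVec i)

theorem trivializationAt_snd_eq_mfderiv (x : M) {p : M} (hp : p ∈ (extChartAt (𝓡 d) x).source)
    (v : TangentSpace (𝓡 d) p) :
    (trivializationAt (Rd d) (TangentSpace (𝓡 d)) x (⟨p, v⟩ : TangentBundle (𝓡 d) M)).2 =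
      mfderiv (𝓡 d) 𝓘(ℝ, Rd d) (extChartAt (𝓡 d) x) p v := by
  have : IsManifold (𝓡 d) 1 M := IsManifold.of_le (n := ∞) (by simp)
  rw [extChartAt_source] at hp
  have h : (trivializationAt (Rd d) (TangentSpace (𝓡 d)) x).continuousLinearMapAt ℝ p v =
      (trivializationAt (Rd d) (TangentSpace (𝓡 d)) x (⟨p, v⟩ : TangentBundle (𝓡 d) M)).2 := by
    rw [Bundle.Trivialization.continuousLinearMapAt_apply,
      Bundle.Trivialization.linearMapAt_apply, if_pos (by simpa using hp)]
  rw [← h]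
  exact DFunLike.congr_fun (TangentBundle.continuousLinearMapAt_trivializationAt hp) v

/-- In the trivialization attached to the chart at `x` this field is the constant `stdVec i`. -/
theorem contMDiffOn_chartBasisVec (x : M) (i : Fin d) :
    ContMDiffOn 𝓘(ℝ, Rd d) (𝓡 d).tangent 1
      (fun u => (⟨(extChartAt (𝓡 d) x).symm u, chartBasisVec x u i⟩ : TangentBundle (𝓡 d) M))
      (extChartAt (𝓡 d) x).target := by
  have : IsManifold (𝓡 d) 1 M := IsManifold.of_le (n := ∞) (by simp)
  have : IsManifold (𝓡 d) (1 + 1) M := IsManifold.of_le (n := ∞) (by norm_num; exact ENat.LEInfty.out)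
  have hmaps : MapsTo
      (fun u => (⟨(extChartAt (𝓡 d) x).symm u, chartBasisVec x u i⟩ : TangentBundle (𝓡 d) M))
      (extChartAt (𝓡 d) x).target
      (trivializationAt (Rd d) (TangentSpace (𝓡 d) : M → Type _) x).source := by
    intro u hu
    rw [Bundle.Trivialization.mem_source]
    have := (extChartAt (𝓡 d) x).map_target hu
    rw [extChartAt_source] at this
    simpa using this
  rw [Bundle.Trivialization.contMDiffOn_iff hmaps]
  refine ⟨contMDiffOn_extChartAt_symm x, ?_⟩
  refine (contMDiffOn_const (c := (stdVec i : Rd d))).congr fun u hu => ?_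
  rw [trivializationAt_snd_eq_mfderiv x ((extChartAt (𝓡 d) x).map_target hu),
    mfderiv_extChartAt_chartBasisVec x hu i]

theorem contDiffOn_chartGram (r : SmoothMetric d M) (x : M) (i j : Fin d) :
    ContDiffOn ℝ 1 (fun u => chartGram r x u i j) (extChartAt (𝓡 d) x).target := by
  have : IsManifold (𝓡 d) 1 M := IsManifold.of_le (n := ∞) (by simp)
  have : IsManifold (𝓡 d) (1 + 1) M := IsManifold.of_le (n := ∞) (by norm_num; exact ENat.LEInfty.out)
  intro u hu
  have hr : ContMDiffWithinAt 𝓘(ℝ, Rd d) ((𝓡 d).prod 𝓘(ℝ, Rd d →L[ℝ] Rd d →L[ℝ] ℝ)) 1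
      (fun u => Bundle.TotalSpace.mk' (Rd d →L[ℝ] Rd d →L[ℝ] ℝ)
        (E := fun p : M => TangentSpace (𝓡 d) p →L[ℝ] TangentSpace (𝓡 d) p →L[ℝ] ℝ)
        ((extChartAt (𝓡 d) x).symm u) (r.inner ((extChartAt (𝓡 d) x).symm u)))
      (extChartAt (𝓡 d) x).target u :=
    ((r.contMDiff.of_le (by simp)).contMDiffAt).comp_contMDiffWithinAt u
      (contMDiffOn_extChartAt_symm x u hu)
  have h : ContMDiffWithinAt 𝓘(ℝ, Rd d) ((𝓡 d).prod 𝓘(ℝ)) 1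
      (fun u => Bundle.TotalSpace.mk' ℝ (E := Bundle.Trivial M ℝ) ((extChartAt (𝓡 d) x).symm u)
        (chartGram r x u i j)) (extChartAt (𝓡 d) x).target u :=
    ContMDiffWithinAt.clm_bundle_apply₂ (F₁ := Rd d) (F₂ := Rd d) hr
      (contMDiffOn_chartBasisVec x i u hu) (contMDiffOn_chartBasisVec x j u hu)
  rw [Bundle.contMDiffWithinAt_totalSpace] at h
  exact h.2.contDiffWithinAt

/-- The differential of the chart sends `∑ cᵢ ∂ᵢ` to `c`, so the `∂ᵢ` are linearly independent and
positivity of `r` applies. -/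
theorem chartGram_posDef (r : SmoothMetric d M) (x : M) {u : Rd d}
    (hu : u ∈ (extChartAt (𝓡 d) x).target) : (chartGram r x u).PosDef := by
  refine ⟨?_, fun c hc => ?_⟩
  · ext i j
    exact r.symm _ (chartBasisVec x u j) (chartBasisVec x u i)
  set p := (extChartAt (𝓡 d) x).symm u
  let w : TangentSpace (𝓡 d) p := ∑ i, c i • chartBasisVec x u i
  have hw : w ≠ 0 := by
    intro h0
    have h1 : mfderiv (𝓡 d) 𝓘(ℝ, Rd d) (extChartAt (𝓡 d) x) p w = (∑ i, c i • stdVec i : Rd d) := by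
      simp only [w, map_sum, map_smul]
      exact Finset.sum_congr rfl fun i _ => by
        rw [mfderiv_extChartAt_chartBasisVec x hu i]; rfl
    rw [h0, map_zero] at h1
    apply hc
    ext i
    have h2 := congrArg (fun z : Rd d => z i) h1.symm
    have h3 : (∑ j, c j • stdVec j : Rd d) i = c i := by
      simp [stdVec, Pi.single_apply]
    exact h3.symm.trans h2
  have := r.pos p w hw
  refine this.trans_eq (Eq.symm ?_)
  simp only [w, map_sum, map_smul, sum_apply, smul_apply]
  rw [Finsupp.sum_fintype _ _ (by simp)]
  refine Finset.sum_congr rfl fun i _ => ?_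
  rw [Finsupp.sum_fintype _ _ (by simp), Finset.smul_sum]
  refine Finset.sum_congr rfl fun j _ => ?_
  have hs : chartGram r x u i j = r.inner p (chartBasisVec x u j) (chartBasisVec x u i) :=
    r.symm p _ _
  rw [hs]
  simp only [star_trivial, smul_eq_mul]
  ring

theorem chartVolumeFactor_pos (r : SmoothMetric d M) (x : M) {u : Rd d}
    (hu : u ∈ (extChartAt (𝓡 d) x).target) : 0 < chartVolumeFactor r x u :=
  Real.sqrt_pos.2 (chartGram_posDef r x hu).det_pos

theorem contDiffOn_chartVolumeFactor (r : SmoothMetric d M) (x : M) :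
    ContDiffOn ℝ 1 (chartVolumeFactor r x) (extChartAt (𝓡 d) x).target := by
  have h : ContDiffOn ℝ 1 (fun u => (chartGram r x u).det) (extChartAt (𝓡 d) x).target := by
    simp only [Matrix.det_apply']
    exact ContDiffOn.sum fun σ _ => contDiffOn_const.mul
      (contDiffOn_prod fun i _ => contDiffOn_chartGram r x _ _)
  exact h.sqrt fun u hu => (chartGram_posDef r x hu).det_pos.ne'

theorem differentiableAt_chartComponents {v : ∀ p : M, TangentSpace (𝓡 d) p}
    (hv : IsC1VectorField v) (x : M) :
    DifferentiableAt ℝ (chartComponents v x) (extChartAt (𝓡 d) x x) := by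
  have : IsManifold (𝓡 d) 1 M := IsManifold.of_le (n := ∞) (by simp)
  have : IsManifold (𝓡 d) (1 + 1) M := IsManifold.of_le (n := ∞) (by norm_num; exact ENat.LEInfty.out)
  have hx : extChartAt (𝓡 d) x x ∈ (extChartAt (𝓡 d) x).target := mem_extChartAt_target x
  have hn : (extChartAt (𝓡 d) x).target ∈ 𝓝 (extChartAt (𝓡 d) x x) :=
    (isOpen_extChartAt_target x).mem_nhds hx
  have h1 : ContMDiffAt 𝓘(ℝ, Rd d) (𝓡 d).tangent 1
      (fun u => (⟨(extChartAt (𝓡 d) x).symm u, v ((extChartAt (𝓡 d) x).symm u)⟩ :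
        TangentBundle (𝓡 d) M)) (extChartAt (𝓡 d) x x) :=
    (hv _).comp _ ((contMDiffOn_extChartAt_symm x).contMDiffAt hn)
  have h2 := ((trivializationAt (Rd d) (TangentSpace (𝓡 d)) x).contMDiffAt_iff
    (by simp)).1 h1
  refine (h2.2.contDiffAt.differentiableAt one_ne_zero).congr_of_eventuallyEq ?_
  filter_upwards [hn] with u hu
  rw [trivializationAt_snd_eq_mfderiv x ((extChartAt (𝓡 d) x).map_target hu)]
  rfl

theorem chartComponents_extChartAt_self (v : ∀ p : M, TangentSpace (𝓡 d) p) (x : M) :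
    chartComponents v x (extChartAt (𝓡 d) x x) = v x := by
  have : IsManifold (𝓡 d) 1 M := IsManifold.of_le (n := ∞) (by simp)
  have hx : (extChartAt (𝓡 d) x).symm (extChartAt (𝓡 d) x x) = x := extChartAt_to_inv x
  unfold chartComponents
  rw [hx, mfderiv_extChartAt_self]
  rfl

/-- The product rule for the divergence. -/
theorem riemannianDiv_smul (r : SmoothMetric d M) {q : M → ℝ} {v : ∀ p : M, TangentSpace (𝓡 d) p}
    (hq : ContMDiff (𝓡 d) 𝓘(ℝ, ℝ) 1 q) (hv : IsC1VectorField v) (x : M) :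
    riemannianDiv r (fun p => q p • v p) x =
      q x * riemannianDiv r v x +
        NormedSpace.fromTangentSpace (q x) (mfderiv (𝓡 d) 𝓘(ℝ, ℝ) q x (v x)) := by
  set φ := extChartAt (𝓡 d) x with hφ
  set a := φ x with ha
  have hx : φ.symm a = x := extChartAt_to_inv x
  have hta : a ∈ φ.target := mem_extChartAt_target x
  have hn : φ.target ∈ 𝓝 a := (isOpen_extChartAt_target x).mem_nhds hta
  have hV : DifferentiableAt ℝ (chartVolumeFactor r x) a :=
    ((contDiffOn_chartVolumeFactor r x).contDiffAt hn).differentiableAt one_ne_zero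
  have hV0 : chartVolumeFactor r x a ≠ 0 := (chartVolumeFactor_pos r x hta).ne'
  have hc := differentiableAt_chartComponents hv x
  have hcv : chartComponents v x a = v x := chartComponents_extChartAt_self v x
  have hqφ : DifferentiableAt ℝ (q ∘ φ.symm) a := by
    have := hq.mdifferentiable one_ne_zero x
    rw [mdifferentiableAt_iff] at this
    simpa only [writtenInExtChartAt, extChartAt_model_space_eq_id, modelWithCornersSelf_coe,
      Set.range_id, differentiableWithinAt_univ] using! this.2
  have hdq : fderiv ℝ (q ∘ φ.symm) a = mfderiv (𝓡 d) 𝓘(ℝ, ℝ) q x := by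
    rw [(hq.mdifferentiable one_ne_zero x).mfderiv]
    simp only [writtenInExtChartAt, extChartAt_model_space_eq_id, modelWithCornersSelf_coe,
      Set.range_id, fderivWithin_univ]
    rfl
  let c : Rd d := v x
  -- Leibniz with `√(det r) vⁱ` kept as one factor; in the term that differentiates `q`, `√(det r)`
  -- later cancels against its inverse in the divergence.
  have key : ∀ i, fderiv ℝ (fun u => chartVolumeFactor r x u *
      chartComponents (fun p => q p • v p) x u i) a (stdVec i) =
      q x * fderiv ℝ (fun u => chartVolumeFactor r x u * chartComponents v x u i) a (stdVec i) +
      chartVolumeFactor r x a * (c i * fderiv ℝ (q ∘ φ.symm) a (stdVec i)) := by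
    intro i
    have he : (fun u => chartVolumeFactor r x u *
        chartComponents (fun p => q p • v p) x u i) =
        fun u => (q ∘ φ.symm) u * (chartVolumeFactor r x u * chartComponents v x u i) := by
      funext u
      have : chartComponents (fun p => q p • v p) x u = q (φ.symm u) • chartComponents v x u :=
        map_smul (mfderiv (𝓡 d) 𝓘(ℝ, Rd d) (extChartAt (𝓡 d) x) (φ.symm u)) _ _
      rw [this, PiLp.smul_apply]
      simp only [Function.comp_apply, smul_eq_mul]
      ring
    have hci : DifferentiableAt ℝ (fun u => chartComponents v x u i) a :=
      (EuclideanSpace.proj (𝕜 := ℝ) i).differentiableAt.comp a hc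
    rw [he, fderiv_fun_mul hqφ (hV.fun_mul hci)]
    simp only [add_apply, smul_apply, smul_eq_mul,
      Function.comp_apply, hx, hcv, c]
    ring
  have hsum : ∑ i, c i * fderiv ℝ (q ∘ φ.symm) a (stdVec i) =
      NormedSpace.fromTangentSpace (q x) (mfderiv (𝓡 d) 𝓘(ℝ, ℝ) q x (v x)) := by
    have hlin : ∀ D : Rd d →L[ℝ] ℝ, ∑ i, c i * D (stdVec i) = D c := by
      intro D
      have hb : c = ∑ i, c i • stdVec i := by
        ext j
        simp [stdVec, Pi.single_apply]
      conv_rhs => rw [hb]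
      simp [map_sum, map_smul]
    rw [hlin, hdq]
    rfl
  unfold riemannianDiv
  simp only [key, Finset.sum_add_distrib, ← Finset.mul_sum, ← hφ, ← ha, hsum]
  field_simp

end ChartCalculus

/-! ### Full support and uniqueness of continuous densities -/

section Measure

theorem map_withDensity_comp {α β : Type*} [MeasurableSpace α] [MeasurableSpace β] (μ : Measure α)
    {H : α → β} (hH : Measurable H) {g : β → ℝ≥0∞} (hg : Measurable g) :
    (μ.withDensity (g ∘ H)).map H = (μ.map H).withDensity g := by
  ext s hs
  rw [Measure.map_apply hH hs, withDensity_apply _ (hH hs), withDensity_apply _ hs,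
    setLIntegral_map hs hg hH]
  rfl

variable {d : ℕ} {M : Type*} [TopologicalSpace M] [ChartedSpace (Rd d) M]
  [IsManifold (𝓡 d) ∞ M] [MeasurableSpace M]

/-- A non-integrable `ρ` would have Bochner integral `0`, not `1`. -/
theorem IsPosC1Density.isFiniteMeasure {r : SmoothMetric d M} {ρ : M → ℝ}
    (hρ : IsPosC1Density r ρ) : IsFiniteMeasure (measureOfDensity r ρ) := by
  have hint : Integrable ρ (riemannianVolume r) := by
    by_contra h
    have := hρ.integral_eq_one
    rw [integral_undef h] at this
    exact zero_ne_one this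
  exact isFiniteMeasure_withDensity_ofReal hint.2

variable [BorelSpace M]

/-- The volume dominates each `chartVolume r x`, which has a positive density with respect to
Lebesgue measure in the chart. Full support is what turns a.e. equality of continuous functions into
equality. -/
theorem riemannianVolume_isOpenPosMeasure (r : SmoothMetric d M) :
    (riemannianVolume r).IsOpenPosMeasure := by
  refine ⟨fun U hU ⟨x, hx⟩ h0 => ?_⟩
  have h1 : chartVolume r x U = 0 :=
    le_antisymm (h0 ▸ (le_iSup (chartVolume r) x : _ ≤ riemannianVolume r) U) bot_le
  set φ := extChartAt (𝓡 d) x with hφ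
  have hT : MeasurableSet φ.target := (isOpen_extChartAt_target x).measurableSet
  have hsymm : ContinuousOn φ.symm φ.target := continuousOn_extChartAt_symm x
  have hV : AEMeasurable (fun u => ENNReal.ofReal (chartVolumeFactor r x u))
      ((volume : Measure (Rd d)).restrict φ.target) :=
    ((contDiffOn_chartVolumeFactor r x).continuousOn.aemeasurable hT).ennreal_ofReal
  have hV0 : ∀ᵐ u ∂((volume : Measure (Rd d)).restrict φ.target),
      ENNReal.ofReal (chartVolumeFactor r x u) ≠ 0 := by
    filter_upwards [ae_restrict_mem hT] with u hu
    exact (ENNReal.ofReal_pos.2 (chartVolumeFactor_pos r x hu)).ne'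
  rw [chartVolume, Measure.map_apply_of_aemeasurable
    ((hsymm.aemeasurable hT).mono_ac (withDensity_absolutelyContinuous _ _)) hU.measurableSet] at h1
  have h2 := withDensity_absolutelyContinuous' hV hV0 h1
  have hW : IsOpen (φ.target ∩ φ.symm ⁻¹' U) :=
    hsymm.isOpen_inter_preimage (isOpen_extChartAt_target x) hU
  have h3 : (volume : Measure (Rd d)) (φ.target ∩ φ.symm ⁻¹' U) = 0 := by
    rwa [Measure.restrict_apply₀' hT.nullMeasurableSet, inter_comm] at h2
  refine hW.measure_ne_zero volume ⟨φ x, mem_extChartAt_target x, ?_⟩ h3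
  simpa only [mem_preimage, hφ, extChartAt_to_inv] using hx

theorem measureOfDensity_isOpenPosMeasure (r : SmoothMetric d M) {p : M → ℝ} (hp : Continuous p)
    (hpos : ∀ x, 0 < p x) : (measureOfDensity r p).IsOpenPosMeasure := by
  have := riemannianVolume_isOpenPosMeasure r
  exact (withDensity_absolutelyContinuous' hp.measurable.ennreal_ofReal.aemeasurable
    (ae_of_all _ fun x => (ENNReal.ofReal_pos.2 (hpos x)).ne')).isOpenPosMeasure

theorem measureOfDensity_mul (r : SmoothMetric d M) {p q : M → ℝ} (hp : Continuous p)
    (hq : Continuous q) (hp0 : ∀ x, 0 ≤ p x) :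
    measureOfDensity r (fun x => p x * q x) =
      (measureOfDensity r p).withDensity fun x => ENNReal.ofReal (q x) := by
  rw [measureOfDensity, measureOfDensity,
    ← withDensity_mul _ hp.measurable.ennreal_ofReal hq.measurable.ennreal_ofReal]
  congr 1
  funext x
  exact ENNReal.ofReal_mul (hp0 x)

theorem densityOf_eq (r : SmoothMetric d M) {μ : Measure M} [IsFiniteMeasure μ] {p : M → ℝ}
    (hp : Continuous p) (hp0 : ∀ x, 0 ≤ p x) (hμ : μ = measureOfDensity r p) :
    densityOf r μ = p := by
  have := riemannianVolume_isOpenPosMeasure r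
  have h : ∃ p : M → ℝ, Continuous p ∧ (∀ x, 0 ≤ p x) ∧ μ = measureOfDensity r p :=
    ⟨p, hp, hp0, hμ⟩
  obtain ⟨hc, hc0, hcμ⟩ := h.choose_spec
  rw [densityOf, dif_pos h]
  have hae := (withDensity_eq_iff hp.measurable.ennreal_ofReal.aemeasurable
    hc.measurable.ennreal_ofReal.aemeasurable (μ := riemannianVolume r) (by
      rw [← setLIntegral_univ, ← withDensity_apply _ MeasurableSet.univ]
      exact ((congrArg (· univ) hμ).symm.trans_ne (measure_ne_top μ univ)))).1
    (hμ.symm.trans hcμ)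
  refine (hc.ae_eq_iff_eq (riemannianVolume r) hp).1 ?_
  filter_upwards [hae] with x hx
  exact ((ENNReal.ofReal_eq_ofReal_iff (hp0 x) (hc0 x)).1 hx).symm

/-- A continuous density of a measure of full support has no zeros if the quotient of some positive
function by it (with the value `0` at its zeros) is continuous. -/
theorem density_pos_of_continuous_div (r : SmoothMetric d M) {a p : M → ℝ} (ha : Continuous a)
    (hapos : ∀ x, 0 < a x) (hp : Continuous p) (hp0 : ∀ x, 0 ≤ p x)
    [hop : (measureOfDensity r p).IsOpenPosMeasure] (hdiv : Continuous fun x => a x / p x) (x : M) :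
    0 < p x := by
  -- A nonempty open set on which `p` vanishes would have measure zero.
  have hdense : Dense {x | p x ≠ 0} := by
    rw [dense_iff_inter_open]
    intro U hU hne
    by_contra hemp
    rw [not_nonempty_iff_eq_empty] at hemp
    refine hU.measure_ne_zero (measureOfDensity r p) hne ?_
    rw [measureOfDensity, withDensity_apply _ hU.measurableSet]
    refine setLIntegral_eq_zero hU.measurableSet fun z hz => ?_
    have : p z = 0 := by
      by_contra hpz
      exact (hemp ▸ (⟨hz, hpz⟩ : z ∈ U ∩ {x | p x ≠ 0}) : z ∈ (∅ : Set M))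
    simp [this]
  have heq : (fun x => a x / p x * p x) = a :=
    (hdiv.mul hp).ext_on hdense ha fun z hz => div_mul_cancel₀ _ hz
  refine (hp0 x).lt_of_ne' fun h0 => (hapos x).ne' ?_
  rw [← congrFun heq x, h0, mul_zero]

end Measure

/-! ### Backward orbits and the delay map -/

section Dynamics

/-- Starting `n` steps in the past turns forward observations into backward ones: `h^i h^{-n} =
h^{-(n-i)}`. -/
theorem delayMap_comp_symm_iterate_apply {M : Type*} (y : M → ℝ) (h : M ≃ M) (n : ℕ) (x : M)
    (i : Fin (n + 1)) :
    delayMap y h (n + 1) (h.symm^[n] x) i = y (h.symm^[n - i] x) := by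
  have hi : (i : ℕ) ≤ n := Nat.lt_succ_iff.1 i.2
  change y (h^[(i : ℕ)] (h.symm^[n] x)) = y (h.symm^[n - (i : ℕ)] x)
  generalize (i : ℕ) = j at hi
  obtain ⟨k, rfl⟩ := Nat.exists_eq_add_of_le hi
  rw [iterate_add_apply, (show LeftInverse h h.symm from h.apply_symm_apply).iterate,
    Nat.add_sub_cancel_left]

/-- The values of an observable along the backward orbit separate points if the delay map is
injective. -/
theorem eq_of_backward_orbit_eq {M : Type*} {y : M → ℝ} {h : M ≃ M} {n : ℕ}
    (hinj : Injective (delayMap y h (n + 1))) {x x' : M}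
    (hx : ∀ k ≤ n, y (h.symm^[k] x) = y (h.symm^[k] x')) : x = x' := by
  refine h.symm.injective.iterate n (hinj ?_)
  ext i
  rw [delayMap_comp_symm_iterate_apply, delayMap_comp_symm_iterate_apply]
  exact hx _ (Nat.sub_le _ _)

variable {d : ℕ} {M : Type*} [TopologicalSpace M] [ChartedSpace (Rd d) M]

theorem contMDiff_iterate {n : ℕ∞ω} {f : M → M} (hf : ContMDiff (𝓡 d) (𝓡 d) n f) (k : ℕ) :
    ContMDiff (𝓡 d) (𝓡 d) n f^[k] := by
  induction k with
  | zero => exact contMDiff_id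
  | succ k ih => exact ih.comp hf

/-- The differentials of an observable along the backward orbit separate tangent vectors if the
delay map has injective differentials. -/
theorem eq_of_mfderiv_backward_orbit_eq {y : M → ℝ} {h : M ≃ₘ^1⟮𝓡 d, 𝓡 d⟯ M} {n : ℕ}
    (hsmooth : ContMDiff (𝓡 d) 𝓘(ℝ, Rd (n + 1)) 1 (delayMap y h (n + 1)))
    (hinj : ∀ x, Injective (mfderiv (𝓡 d) 𝓘(ℝ, Rd (n + 1)) (delayMap y h (n + 1)) x))
    {x : M} {v w : TangentSpace (𝓡 d) x}
    (hvw : ∀ k ≤ n, mfderiv (𝓡 d) 𝓘(ℝ, ℝ) (fun p => y (h.symm^[k] p)) x v =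
      mfderiv (𝓡 d) 𝓘(ℝ, ℝ) (fun p => y (h.symm^[k] p)) x w) : v = w := by
  set S : M → M := h.symm^[n] with hS
  have hSd : MDifferentiableAt (𝓡 d) (𝓡 d) S x :=
    (contMDiff_iterate h.symm.contMDiff n).mdifferentiable one_ne_zero x
  have hTd : MDifferentiableAt (𝓡 d) (𝓡 d) h^[n] (S x) :=
    (contMDiff_iterate h.contMDiff n).mdifferentiable one_ne_zero _
  have hDd := hsmooth.mdifferentiable one_ne_zero (S x)
  have hTS : h^[n] ∘ S = id := funext fun p =>
    (show LeftInverse h h.symm from h.toEquiv.apply_symm_apply).iterate n p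
  -- The differential of `h^n` is a left inverse, by the chain rule.
  have hSinj : Injective (mfderiv (𝓡 d) (𝓡 d) S x) := by
    have hc := mfderiv_comp x hTd hSd
    rw [hTS, mfderiv_id] at hc
    exact LeftInverse.injective fun u => (DFunLike.congr_fun hc u).symm
  refine hSinj (hinj (S x) ?_)
  have hcomp := mfderiv_comp x hDd hSd
  suffices H : mfderiv (𝓡 d) 𝓘(ℝ, Rd (n + 1)) (delayMap y h (n + 1) ∘ S) x v =
      mfderiv (𝓡 d) 𝓘(ℝ, Rd (n + 1)) (delayMap y h (n + 1) ∘ S) x w by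
    rw [hcomp] at H
    exact H
  have hcoord : ∀ (i : Fin (n + 1)) (u : TangentSpace (𝓡 d) x),
      (mfderiv (𝓡 d) 𝓘(ℝ, Rd (n + 1)) (delayMap y h (n + 1) ∘ S) x u : Rd (n + 1)).ofLp i =
        mfderiv (𝓡 d) 𝓘(ℝ, ℝ) (fun p => y (h.symm^[n - i] p)) x u := by
    intro i u
    have hfun : (fun p => y (h.symm^[n - i] p)) =
        (EuclideanSpace.proj (𝕜 := ℝ) i : Rd (n + 1) →L[ℝ] ℝ) ∘ (delayMap y h (n + 1) ∘ S) :=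
      funext fun p => (delayMap_comp_symm_iterate_apply y h.toEquiv n p i).symm
    have hc := mfderiv_comp x
      (EuclideanSpace.proj (𝕜 := ℝ) i : Rd (n + 1) →L[ℝ] ℝ).differentiableAt.mdifferentiableAt
      (hDd.comp x hSd)
    rw [hfun, hc, mfderiv_eq_fderiv, ContinuousLinearMap.fderiv]
    rfl
  refine PiLp.ext fun i => ?_
  refine (hcoord i v).trans (Eq.trans ?_ (hcoord i w).symm)
  exact hvw _ (Nat.sub_le _ _)

end Dynamics

/-! ### The two uniqueness statements -/

section Uniqueness

theorem pushforwardUniqueness_of_subsingleton {d m : ℕ} {M : Type*} [TopologicalSpace M]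
    [ChartedSpace (Rd d) M] [MeasurableSpace M] [Subsingleton M]
    {N : Type*} [TopologicalSpace N] [ChartedSpace (Rd d) N] [MeasurableSpace N]
    (ρ : Fin m → Measure M) : PushforwardUniqueness (d := d) N ρ := by
  intro f g _
  ext x
  rw [← f.apply_symm_apply (g x), Subsingleton.elim (f.symm (g x)) x]

variable {d m : ℕ} {M : Type*} [TopologicalSpace M] [ChartedSpace (Rd d) M] [MeasurableSpace M] [BorelSpace M]

/-- The quotient of consecutive iterated pushforwards is the observable along the backward orbit,
so that the observable is determined by these measures. -/
theorem map_iterate_succ_eq_withDensity {μ : Measure M} {y : M → ℝ} {h : M ≃ₘ^1⟮𝓡 d, 𝓡 d⟯ M}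
    (hy : Continuous y)
    (hμ : μ.map h = μ.withDensity fun x => ENNReal.ofReal (y x)⁻¹) (k : ℕ) :
    μ.map h^[k + 1] =
      (μ.map h^[k]).withDensity fun x => ENNReal.ofReal (y (h.symm^[k] x))⁻¹ := by
  have hk : Measurable h^[k] := (h.continuous.iterate k).measurable
  have hg : Measurable fun x => ENNReal.ofReal (y (h.symm^[k] x))⁻¹ :=
    (hy.comp (h.symm.continuous.iterate k)).measurable.inv.ennreal_ofReal
  rw [iterate_succ, ← Measure.map_map hk h.continuous.measurable, hμ,
    ← map_withDensity_comp μ hk hg]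
  congr 2
  funext x
  simp only [comp_apply]
  rw [(show LeftInverse h.symm h from h.toEquiv.symm_apply_apply).iterate k x]

theorem pushforwardUniqueness_of_injective_delayMap
    {N : Type*} [TopologicalSpace N] [ChartedSpace (Rd d) N] [MeasurableSpace N] [BorelSpace N]
    {μ : Measure M} [IsFiniteMeasure μ] [μ.IsOpenPosMeasure] {y : M → ℝ}
    {h : M ≃ₘ^1⟮𝓡 d, 𝓡 d⟯ M} (hy : Continuous y) (hpos : ∀ x, 0 < y x)
    (hμ : μ.map h = μ.withDensity fun x => ENNReal.ofReal (y x)⁻¹) {n : ℕ} (hm : n + 1 < m)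
    (hinj : Injective (delayMap y h (n + 1))) :
    PushforwardUniqueness (d := d) N (fun j : Fin m => μ.map h^[(j : ℕ)]) := by
  intro f g hfg
  have hmap : ∀ (e : M ≃ₘ^1⟮𝓡 d, 𝓡 d⟯ N) (k : ℕ), (μ.map h^[k + 1]).map e =
      ((μ.map h^[k]).map e).withDensity
        fun z => ENNReal.ofReal (y (h.symm^[k] (e.symm z)))⁻¹ := by
    intro e k
    have hg : Measurable fun z => ENNReal.ofReal (y (h.symm^[k] (e.symm z)))⁻¹ :=
      (hy.comp ((h.symm.continuous.iterate k).comp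
        e.symm.continuous)).measurable.inv.ennreal_ofReal
    rw [map_iterate_succ_eq_withDensity hy hμ,
      ← map_withDensity_comp _ e.continuous.measurable hg]
    congr 2
    funext x
    simp only [comp_apply, e.symm_apply_apply]
  -- The relative densities in `hmap` involve the inverses, so these are the maps that get compared.
  have hsymm : ∀ z, f.symm z = g.symm z := by
    intro z
    refine eq_of_backward_orbit_eq (h := h.toEquiv) hinj fun k hk => ?_
    have hkm : k + 1 < m := by omega
    set ν := (μ.map h^[k]).map f with hν
    have hνfin : IsFiniteMeasure ν := inferInstance
    have hνpos : ν.IsOpenPosMeasure := by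
      rw [hν, Measure.map_map f.continuous.measurable (h.continuous.iterate k).measurable]
      exact (f.continuous.comp (h.continuous.iterate k)).isOpenPosMeasure_map
        (f.surjective.comp (h.surjective.iterate k))
    have hcont : ∀ e : M ≃ₘ^1⟮𝓡 d, 𝓡 d⟯ N,
        Continuous fun z => (y (h.symm^[k] (e.symm z)))⁻¹ := fun e =>
      (hy.comp ((h.symm.continuous.iterate k).comp e.symm.continuous)).inv₀ fun z => (hpos _).ne'
    -- The hypothesis at `k` makes the base measure common to `f` and `g`; the hypothesis at `k + 1`
    -- then equates the two weighted measures.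
    have heq : (ν.withDensity fun z => ENNReal.ofReal (y (h.symm^[k] (f.symm z)))⁻¹) =
        ν.withDensity fun z => ENNReal.ofReal (y (h.symm^[k] (g.symm z)))⁻¹ := by
      rw [hν, ← hmap f k, hfg ⟨k, by omega⟩, ← hmap g k]
      exact hfg ⟨k + 1, hkm⟩
    rw [withDensity_eq_iff_of_sigmaFinite (hcont f).measurable.ennreal_ofReal.aemeasurable
      (hcont g).measurable.ennreal_ofReal.aemeasurable] at heq
    have hfun := ((hcont f).ae_eq_iff_eq ν (hcont g)).1 (by
      filter_upwards [heq] with z hz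
      exact (ENNReal.ofReal_eq_ofReal_iff (inv_nonneg.2 (hpos _).le)
        (inv_nonneg.2 (hpos _).le)).1 hz)
    exact inv_injective (congrFun hfun z)
  ext x
  have := hsymm (f x)
  rw [f.symm_apply_apply] at this
  conv_rhs => rw [this]
  exact (g.apply_symm_apply _).symm

theorem divergenceUniqueness_of_immersion_delayMap [IsManifold (𝓡 d) ∞ M] (r : SmoothMetric d M) {ρ y : M → ℝ}
    [IsFiniteMeasure (measureOfDensity r ρ)] {h : M ≃ₘ^1⟮𝓡 d, 𝓡 d⟯ M}
    (hρ : ContMDiff (𝓡 d) 𝓘(ℝ, ℝ) 1 ρ) (hρpos : ∀ x, 0 < ρ x)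
    (hy : ContMDiff (𝓡 d) 𝓘(ℝ, ℝ) 1 y) (hypos : ∀ x, 0 < y x)
    (hμ : (measureOfDensity r ρ).map h =
      (measureOfDensity r ρ).withDensity fun x => ENNReal.ofReal (y x)⁻¹)
    {n : ℕ} (hm : n + 1 < m)
    (hsmooth : ContMDiff (𝓡 d) 𝓘(ℝ, Rd (n + 1)) 1 (delayMap y h (n + 1)))
    (hinj : ∀ x, Injective (mfderiv (𝓡 d) 𝓘(ℝ, Rd (n + 1)) (delayMap y h (n + 1)) x)) :
    DivergenceUniqueness r (fun j : Fin m => (measureOfDensity r ρ).map h^[(j : ℕ)]) := by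
  set q : ℕ → M → ℝ := fun k x => y (h.symm^[k] x) with hq
  have hqC : ∀ k, ContMDiff (𝓡 d) 𝓘(ℝ, ℝ) 1 (q k) := fun k =>
    hy.comp (contMDiff_iterate h.symm.contMDiff k)
  have hqpos : ∀ k x, 0 < q k x := fun k x => hypos _
  have hqinv : ∀ k, ContMDiff (𝓡 d) 𝓘(ℝ, ℝ) 1 fun x => (q k x)⁻¹ := fun k x =>
    ContDiffAt.comp_contMDiffAt (contDiffAt_inv ℝ (hqpos k x).ne') (hqC k x)
  -- Building the densities from the ratios makes them `C¹` and positive by induction, with no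
  -- Jacobian of `h` involved.
  let P : ℕ → M → ℝ := fun k => Nat.rec ρ (fun k p x => p x * (q k x)⁻¹) k
  have hPsucc : ∀ k x, P k x = q k x * P (k + 1) x := fun k x => by
    change _ = q k x * (P k x * (q k x)⁻¹)
    field_simp [(hqpos k x).ne']
  have hP : ∀ k, ContMDiff (𝓡 d) 𝓘(ℝ, ℝ) 1 (P k) ∧ (∀ x, 0 < P k x) ∧
      (measureOfDensity r ρ).map h^[k] = measureOfDensity r (P k) := by
    intro k
    induction k with
    | zero => exact ⟨hρ, hρpos, Measure.map_id⟩
    | succ k ih =>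
      obtain ⟨hC, hpos, hmap⟩ := ih
      refine ⟨hC.mul (hqinv k), fun x => mul_pos (hpos x) (inv_pos.2 (hqpos k x)), ?_⟩
      rw [map_iterate_succ_eq_withDensity hy.continuous hμ, hmap]
      exact (measureOfDensity_mul r hC.continuous (hqinv k).continuous fun x => (hpos x).le).symm
  have hdens : ∀ k, densityOf r ((measureOfDensity r ρ).map h^[k]) = P k := fun k =>
    densityOf_eq r (hP k).1.continuous (fun x => ((hP k).2.1 x).le) (hP k).2.2
  intro v w hv hw hvw
  funext x
  refine eq_of_mfderiv_backward_orbit_eq hsmooth hinj fun k hk => ?_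
  have hsmul : ∀ u : ∀ p : M, TangentSpace (𝓡 d) p, IsC1VectorField u →
      riemannianDiv r (fun p => P k p • u p) x =
        q k x * riemannianDiv r (fun p => P (k + 1) p • u p) x +
        P (k + 1) x * NormedSpace.fromTangentSpace (q k x) (mfderiv (𝓡 d) 𝓘(ℝ, ℝ) (q k) x (u x)) := by
    intro u hu
    have hPu : IsC1VectorField fun p => P (k + 1) p • u p :=
      ContMDiff.smul_section (hP (k + 1)).1 hu
    have hmul : (fun p => P k p • u p) = fun p => q k p • (P (k + 1) p • u p) := by
      funext p
      rw [smul_smul, hPsucc k p]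
    rw [hmul, riemannianDiv_smul r (hqC k) hPu, map_smul, map_smul, smul_eq_mul]
  have h0 := hvw ⟨k, by omega⟩ x
  have h1 := hvw ⟨k + 1, by omega⟩ x
  simp only [hdens] at h0 h1
  -- The divergence at index `k + 1` is common to both sides and cancels, leaving `P_{k+1} dq_k(v) =
  -- P_{k+1} dq_k(w)`.
  rw [hsmul v hv, hsmul w hw, h1, add_right_inj] at h0
  exact (NormedSpace.fromTangentSpace (q k x)).injective
    (mul_left_cancel₀ ((hP (k + 1)).2.1 x).ne' h0)

end Uniqueness

/-! ### The main theorem -/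

theorem theorem2 (d m : ℕ) (hm : 2 * d + 1 < m)
    {M : Type*} [TopologicalSpace M] [T2Space M] [CompactSpace M]
    [ChartedSpace (Rd d) M] [IsManifold (𝓡 d) ∞ M] [MeasurableSpace M] [BorelSpace M]
    (r : SmoothMetric d M)
    {N : Type*} [TopologicalSpace N] [T2Space N] [CompactSpace N]
    [ChartedSpace (Rd d) N] [IsManifold (𝓡 d) ∞ N] [MeasurableSpace N] [BorelSpace N]
    (ρ₁ : M → ℝ) (hρ₁ : IsPosC1Density r ρ₁) (h : M ≃ₘ^2⟮𝓡 d, 𝓡 d⟯ M)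
    (hG : ((fun x => ρ₁ x / densityOf r (Measure.map h (measureOfDensity r ρ₁)) x), diffToC1 h)
      ∈ takensSet d M) :
    PushforwardUniqueness (d := d) N (iteratedPushforward r ρ₁ h m) ∧
      DivergenceUniqueness r (iteratedPushforward r ρ₁ h m) := by
  set ν := (measureOfDensity r ρ₁).map h with hν
  have hy : ContMDiff (𝓡 d) 𝓘(ℝ, ℝ) 1 fun x => ρ₁ x / densityOf r ν x := hG.1
  have hemb : IsC1Embedding (d := d)
    (delayMap (fun x => ρ₁ x / densityOf r ν x) (diffToC1 h) (2 * d + 1)) := hG.2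
  have hfin := hρ₁.isFiniteMeasure
  have hop := measureOfDensity_isOpenPosMeasure r hρ₁.contMDiff.continuous hρ₁.pos
  -- Splitting on the existence of a continuous density avoids the change of variables formula: the
  -- embedding hypothesis settles the other case too.
  by_cases hex : ∃ p : M → ℝ, Continuous p ∧ (∀ x, 0 ≤ p x) ∧ ν = measureOfDensity r p
  · obtain ⟨p, hp, hp0, hνp⟩ := hex
    have hd : densityOf r ν = p := densityOf_eq r hp hp0 hνp
    rw [hd] at hy hemb
    have hνop : (measureOfDensity r p).IsOpenPosMeasure :=
      hνp ▸ h.continuous.isOpenPosMeasure_map h.surjective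
    -- `p` is so far only nonnegative; continuity of the observable `ρ₁ / p` excludes zeros.
    have hppos := density_pos_of_continuous_div r hρ₁.contMDiff.continuous hρ₁.pos hp hp0
      hy.continuous
    have hypos : ∀ x, 0 < ρ₁ x / p x := fun x => div_pos (hρ₁.pos x) (hppos x)
    have hrel : (measureOfDensity r ρ₁).map (diffToC1 h) =
        (measureOfDensity r ρ₁).withDensity fun x => ENNReal.ofReal (ρ₁ x / p x)⁻¹ := by
      refine Eq.trans ?_ (measureOfDensity_mul r hρ₁.contMDiff.continuous
        (hy.continuous.inv₀ fun x => (hypos x).ne') fun x => (hρ₁.pos x).le)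
      refine hνp.trans (congrArg (measureOfDensity r) (funext fun x => ?_))
      have := (hρ₁.pos x).ne'
      field_simp
    have hiter : iteratedPushforward r ρ₁ h m =
        fun j : Fin m => (measureOfDensity r ρ₁).map (diffToC1 h)^[(j : ℕ)] := rfl
    rw [hiter]
    constructor
    · exact pushforwardUniqueness_of_injective_delayMap (n := 2 * d) hy.continuous hypos hrel hm
        hemb.injective
    · exact divergenceUniqueness_of_immersion_delayMap (n := 2 * d) r hρ₁.contMDiff hρ₁.pos hy
        hypos hrel hm hemb.contMDiff hemb.injective_mfderiv
  · -- Without a continuous density of `ν` the delay map would be constant.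
    have hd : densityOf r ν = 0 := dif_neg hex
    have hconst : delayMap (fun x => ρ₁ x / densityOf r ν x) (diffToC1 h) (2 * d + 1) =
        fun _ => 0 := by
      funext x
      ext i
      simp [delayMap, hd]
    have hM : Subsingleton M := ⟨fun x x' => hemb.injective (by simp only [hconst])⟩
    refine ⟨pushforwardUniqueness_of_subsingleton _, fun v w _ _ _ => funext fun x => ?_⟩
    -- The differential of the constant delay map is zero, and an injective zero map forces `v x = w
    -- x`.
    have hinj := hemb.injective_mfderiv x
    rw [hconst, mfderiv_const] at hinj
    exact hinj rfl
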